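/- Let $d,n$ be positive integers with $2d\mid n$. A family $\mathcal F\subseteq\binom{[n]}{n/d}$ is called $d$-Galvin if for every $A\subseteq[n]$ with $|A|=n/2$ there are sets $S_1,\dots,S_d\in\mathcal F$ that form a partition of $[n]$ and satisfy $|S_i\cap A|=\frac{n}{2d}$ for every $i$. Theorem. There exist absolute constants $c_1,c_2\in\mathbb Z$ such that for all positive integers $d,n$ with $2d\mid n$, writing $f=n^2d^9$, there is a $d$-Galvin family $\mathcal F\subseteq\binom{[n]}{n/d}$ whose size satisfies $$\min\Big\{f\,(\ln f)^{c_1},\ \tbinom{n}{n/d}\Big\}\ \le\ |\mathcal F|\ \le\ f\,(\ln f)^{c_2}.$$ That is, there is a $d$-Galvin family of size $\tilde\Theta(n^2d^9)$, where the lower bound on the size is capped at $\binom{n}{n/d}$, the number of all $(n/d)$-element subsets of $[n]$. -/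

import Mathlib

/-- `S` is balanced on `A`: `|S ∩ A| = |S| / 2`. -/
def BalancedOn {n : ℕ} (S A : Finset (Fin n)) : Prop :=
  2 * (S ∩ A).card = S.card

/-- `A` is handled by `F` (with `d` parts): some `S₁, …, S_d ∈ F` partition the ground set
and are all balanced on `A`. -/
def IsHandledBy {n : ℕ} (d : ℕ) (F : Finset (Finset (Fin n))) (A : Finset (Fin n)) : Prop :=
  ∃ S : Fin d → Finset (Fin n),
    (∀ i, S i ∈ F) ∧
    (∀ i j, i ≠ j → Disjoint (S i) (S j)) ∧
    Finset.univ.biUnion S = Finset.univ ∧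
    ∀ i, BalancedOn (S i) A

/-- `F` is a `d`-Galvin family on the `n`-element set `Fin n` (used for `2 * d ∣ n`, so that
both divisions are exact). -/
def IsGalvinFamily {n : ℕ} (d : ℕ) (F : Finset (Finset (Fin n))) : Prop :=
  F ⊆ Finset.powersetCard (n / d) Finset.univ ∧
  ∀ A ∈ Finset.powersetCard (n / 2) (Finset.univ : Finset (Fin n)), IsHandledBy d F A

/-!
Split `[n]` into `2 * d` blocks of `h = n / (2 * d)` points. For most halving sets `A` every block
meets `A` in a typical number of points (Chebyshev), in which case the blocks can be ordered so
that every partial sum of the discrepancies `2 * |block ∩ A| - h` is at most the largest single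
discrepancy (a one-dimensional Steinitz argument). Take the first block, then consecutive pairs of
blocks, then the last block. Each pair can be cut into two halves, one of which completes what is
left of the previous pair to a balanced set of `2 * h` points, and by the bounded partial sums
both halves again have typical intersections with `A`. A random half of a given pair has the
required intersection with probability `≥ c / (d ^ 3 * √h)`, so about `d ^ 3 * √h * log n`
greedily chosen halves per pair suffice for most `A`. There are then `≲ d ^ 5 * √h * log n`
pieces, and joining two of them gives `≲ d ^ 10 * h * log² n ≈ n * d ^ 9 * log² n` sets. Finally
`n + 1` permuted copies of this family take care of all `A`, and for the lower bound one may add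
arbitrary sets.
-/

open Finset

section Covering

variable {α β : Type*} (s : Finset α)

lemma card_filter_exists_mem_le {ι : Type*} (t : Finset ι) (p : ι → α → Prop)
    [∀ i, DecidablePred (p i)] [DecidablePred fun x => ∃ i ∈ t, p i x] :
    #{x ∈ s | ∃ i ∈ t, p i x} ≤ ∑ i ∈ t, #{x ∈ s | p i x} := by
  classical
  refine (card_le_card fun x hx => ?_).trans card_biUnion_le
  obtain ⟨hxs, i, hi, hpx⟩ := mem_filter.1 hx
  exact mem_biUnion.2 ⟨i, hi, mem_filter.2 ⟨hxs, hpx⟩⟩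

variable {s} {Ω : Finset β} {R : α → β → Prop} {q : ℝ}

lemma exists_card_filter_not_le [∀ x, DecidablePred (R x)] (hΩ : Ω.Nonempty)
    (hq : ∀ x ∈ s, q * #Ω ≤ #{y ∈ Ω | R x y}) :
    ∃ y ∈ Ω, (#{x ∈ s | ¬ R x y} : ℝ) ≤ (1 - q) * #s := by
  classical
  have double_count : ∑ y ∈ Ω, (#{x ∈ s | R x y} : ℝ) = ∑ x ∈ s, (#{y ∈ Ω | R x y} : ℝ) := by
    exact_mod_cast (sum_card_bipartiteAbove_eq_sum_card_bipartiteBelow R).symm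
  have average : ∑ _y ∈ Ω, q * (#s : ℝ) ≤ ∑ y ∈ Ω, (#{x ∈ s | R x y} : ℝ) := by
    calc ∑ _y ∈ Ω, q * (#s : ℝ) = ∑ _x ∈ s, q * (#Ω : ℝ) := by
          simp only [sum_const, nsmul_eq_mul]; ring
      _ ≤ ∑ x ∈ s, (#{y ∈ Ω | R x y} : ℝ) := sum_le_sum hq
      _ = _ := double_count.symm
  obtain ⟨y, hy, hys⟩ := exists_le_of_sum_le hΩ average
  have split : (#{x ∈ s | R x y} : ℝ) + #{x ∈ s | ¬ R x y} = #s := by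
    exact_mod_cast card_filter_add_card_filter_not (s := s) (fun x => R x y)
  exact ⟨y, hy, by linarith⟩

lemma exists_greedy_cover [∀ x, DecidablePred (R x)] (hq1 : q ≤ 1) (hΩ : Ω.Nonempty)
    (hq : ∀ x ∈ s, q * #Ω ≤ #{y ∈ Ω | R x y}) (K : ℕ) :
    ∃ G ⊆ Ω, #G ≤ K ∧ (#{x ∈ s | ∀ y ∈ G, ¬ R x y} : ℝ) ≤ (1 - q) ^ K * #s := by
  classical
  induction K with
  | zero => exact ⟨∅, empty_subset _, by simp, by simp⟩
  | succ K ih =>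
    obtain ⟨G, hGΩ, hGK, hG⟩ := ih
    obtain ⟨y, hy, hys⟩ := exists_card_filter_not_le (s := {x ∈ s | ∀ y ∈ G, ¬ R x y}) hΩ
      fun x hx => hq x (mem_filter.1 hx).1
    refine ⟨insert y G, insert_subset hy hGΩ, (card_insert_le _ _).trans (by omega), ?_⟩
    have missed : {x ∈ s | ∀ z ∈ insert y G, ¬ R x z} =
        {x ∈ {x ∈ s | ∀ z ∈ G, ¬ R x z} | ¬ R x y} := by
      simp only [filter_filter, forall_mem_insert, and_comm]
    calc (#{x ∈ s | ∀ z ∈ insert y G, ¬ R x z} : ℝ)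
        ≤ (1 - q) * #{x ∈ s | ∀ z ∈ G, ¬ R x z} := by rw [missed]; exact hys
      _ ≤ (1 - q) * ((1 - q) ^ K * #s) := by gcongr
      _ = (1 - q) ^ (K + 1) * #s := by ring

end Covering

section Binomials

lemma choose_le_choose_of_le_half {h k w : ℕ} (hkw : k ≤ w) (hw : 2 * w ≤ h) :
    h.choose k ≤ h.choose w := by
  induction w, hkw using Nat.le_induction with
  | base => rfl
  | succ w _ ih =>
    exact (ih (by omega)).trans (Nat.choose_le_succ_of_lt_half_left (by omega))

lemma choose_le_choose_of_abs_le {h k w : ℕ} (hk : k ≤ h) (hw : w ≤ h)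
    (hkw : |2 * (w : ℤ) - h| ≤ |2 * (k : ℤ) - h|) : h.choose k ≤ h.choose w := by
  have fold (x : ℕ) (hx : x ≤ h) :
      h.choose (min x (h - x)) = h.choose x ∧ |2 * (x : ℤ) - h| = h - 2 * (min x (h - x) : ℕ) := by
    rcases le_total (2 * x) h with hx2 | hx2
    · rw [min_eq_left (by omega), abs_of_nonpos (by omega)]
      exact ⟨rfl, by ring⟩
    · rw [min_eq_right (by omega), abs_of_nonneg (by omega)]
      exact ⟨Nat.choose_symm hx, by omega⟩
  rw [(fold w hw).2, (fold k hk).2] at hkw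
  rw [← (fold k hk).1, ← (fold w hw).1]
  exact choose_le_choose_of_le_half (by omega) (by omega)

lemma choose_mul_choose_mul_choose_comm (a b c e : ℕ) :
    (a + b).choose a * (c + e).choose c * (a + c + (b + e)).choose (a + b) =
      (a + c).choose a * (b + e).choose b * (a + c + (b + e)).choose (a + c) := by
  have factor (x y : ℕ) : (x + y).choose x * x.factorial * y.factorial = (x + y).factorial := by
    rw [Nat.choose_symm_add, Nat.add_choose_mul_factorial_mul_factorial]
  have row := factor (a + b) (c + e)
  rw [add_add_add_comm a b c e] at row
  apply Nat.eq_of_mul_eq_mul_right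
    (by positivity : 0 < a.factorial * b.factorial * c.factorial * e.factorial)
  calc _ = (a + c + (b + e)).choose (a + b) * ((a + b).choose a * a.factorial * b.factorial) *
        ((c + e).choose c * c.factorial * e.factorial) := by ring
    _ = (a + c + (b + e)).choose (a + c) * ((a + c).choose a * a.factorial * c.factorial) *
        ((b + e).choose b * b.factorial * e.factorial) := by
        simp only [factor, row]
    _ = _ := by ring

lemma sq_centralBinom_mul_le (k : ℕ) : k.centralBinom ^ 2 * (2 * k + 1) ≤ 16 ^ k := by
  induction k with
  | zero => simp
  | succ k ih =>
    apply Nat.le_of_mul_le_mul_left _ (by positivity : 0 < (k + 1) ^ 2)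
    calc (k + 1) ^ 2 * ((k + 1).centralBinom ^ 2 * (2 * (k + 1) + 1))
        = ((k + 1) * (k + 1).centralBinom) ^ 2 * (2 * k + 3) := by ring
      _ = (k.centralBinom ^ 2 * (2 * k + 1)) * (4 * ((2 * k + 1) * (2 * k + 3))) := by
        rw [Nat.succ_mul_centralBinom_succ]; ring
      _ ≤ 16 ^ k * (16 * (k + 1) ^ 2) := Nat.mul_le_mul ih (by nlinarith)
      _ = (k + 1) ^ 2 * 16 ^ (k + 1) := by ring

lemma le_sq_centralBinom_mul {k : ℕ} (hk : 0 < k) : 16 ^ k ≤ k.centralBinom ^ 2 * (4 * k) := by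
  induction k, hk using Nat.le_induction with
  | base => simp [Nat.centralBinom]
  | succ k hk ih =>
    apply Nat.le_of_mul_le_mul_left _ (by positivity : 0 < k * (k + 1) ^ 2)
    calc k * (k + 1) ^ 2 * 16 ^ (k + 1) = 16 ^ k * (16 * k * (k + 1) ^ 2) := by ring
      _ ≤ (k.centralBinom ^ 2 * (4 * k)) * (16 * k * (k + 1) ^ 2) := Nat.mul_le_mul_right _ ih
      _ = (k.centralBinom ^ 2 * (4 * k * (k + 1))) * (16 * (k * (k + 1))) := by ring
      _ ≤ (k.centralBinom ^ 2 * (4 * k * (k + 1))) * (4 * (2 * k + 1) ^ 2) := by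
        exact Nat.mul_le_mul_left _ (by nlinarith)
      _ = (2 * (2 * k + 1) * k.centralBinom) ^ 2 * (4 * k * (k + 1)) := by ring
      _ = ((k + 1) * (k + 1).centralBinom) ^ 2 * (4 * k * (k + 1)) := by
        rw [Nat.succ_mul_centralBinom_succ]
      _ = k * (k + 1) ^ 2 * ((k + 1).centralBinom ^ 2 * (4 * (k + 1))) := by ring

lemma centralBinom_succ_eq_two_mul (k : ℕ) :
    (k + 1).centralBinom = 2 * (2 * k + 1).choose k := by
  rw [Nat.centralBinom, Nat.mul_succ, Nat.choose_succ_succ, Nat.choose_symm_half, ← two_mul]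

lemma sq_choose_mul_le (N r : ℕ) : N.choose r ^ 2 * (N + 1) ≤ 4 ^ N := by
  refine (Nat.mul_le_mul_right _ (Nat.pow_le_pow_left (Nat.choose_le_middle r N) 2)).trans ?_
  obtain ⟨k, rfl | rfl⟩ := Nat.even_or_odd' N
  · rw [Nat.mul_div_cancel_left k two_pos, pow_mul]
    exact sq_centralBinom_mul_le k
  · have hk := sq_centralBinom_mul_le (k + 1)
    rw [centralBinom_succ_eq_two_mul, show 16 ^ (k + 1) = 4 * 4 ^ (2 * k + 1) by
      rw [pow_succ 4, pow_mul 4]; ring] at hk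
    rw [show (2 * k + 1) / 2 = k by omega]
    nlinarith

lemma two_pow_mul_choose_le {k h : ℕ} (hk : 0 < k) (hh : h ≤ k) (r : ℕ) :
    2 ^ h * (2 * k - h).choose r ≤ 2 * k.centralBinom := by
  rw [← Nat.pow_le_pow_iff_left two_ne_zero]
  refine Nat.le_of_mul_le_mul_right ?_ hk
  calc (2 ^ h * (2 * k - h).choose r) ^ 2 * k
      = 4 ^ h * ((2 * k - h).choose r ^ 2 * k) := by
        rw [show 4 = 2 ^ 2 by rfl, ← pow_mul, mul_comm 2 h]; ring
    _ ≤ 4 ^ h * ((2 * k - h).choose r ^ 2 * (2 * k - h + 1)) := by gcongr; omega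
    _ ≤ 4 ^ h * 4 ^ (2 * k - h) := by gcongr; exact sq_choose_mul_le _ r
    _ = 16 ^ k := by
        rw [← pow_add, show h + (2 * k - h) = 2 * k by omega, pow_mul]; norm_num
    _ ≤ k.centralBinom ^ 2 * (4 * k) := le_sq_centralBinom_mul hk
    _ = (2 * k.centralBinom) ^ 2 * k := by ring

lemma sum_choose_mul_sq (h : ℕ) :
    ∑ k ∈ range (h + 1), (h.choose k : ℝ) * (2 * k - h) ^ 2 = (h : ℝ) * 2 ^ h := by
  have variance := congrArg (Polynomial.eval (1 / 2 : ℝ)) (bernsteinPolynomial.variance ℝ h)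
  simp only [Polynomial.eval_finsetSum, bernsteinPolynomial, Polynomial.eval_mul,
    Polynomial.eval_pow, Polynomial.eval_sub, Polynomial.eval_X, Polynomial.eval_natCast,
    Polynomial.eval_one, nsmul_eq_mul] at variance
  calc ∑ k ∈ range (h + 1), (h.choose k : ℝ) * (2 * k - h) ^ 2
      = 4 * 2 ^ h * ((h : ℝ) * (1 / 2) * (1 - 1 / 2)) := by
        rw [← variance, mul_sum]
        refine sum_congr rfl fun k hk => ?_
        have weight : (2 : ℝ) ^ h * ((1 / 2) ^ k * (1 - 1 / 2) ^ (h - k)) = 1 := by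
          rw [show (1 - 1 / 2 : ℝ) = 1 / 2 by norm_num, ← pow_add,
            Nat.add_sub_cancel' (mem_range_succ_iff.1 hk), ← mul_pow]
          norm_num
        linear_combination (-(h.choose k : ℝ) * (2 * k - h) ^ 2) * weight
    _ = h * 2 ^ h := by ring

lemma sum_choose_le_of_forall_sq_le {h : ℕ} {B : ℝ} (hB : 0 < B) {t : Finset ℕ}
    (ht : t ⊆ range (h + 1)) (hBt : ∀ k ∈ t, B ^ 2 ≤ (2 * (k : ℝ) - h) ^ 2) :
    ∑ k ∈ t, (h.choose k : ℝ) ≤ h * 2 ^ h / B ^ 2 := by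
  rw [le_div_iff₀ (by positivity), ← sum_choose_mul_sq, sum_mul]
  calc ∑ k ∈ t, (h.choose k : ℝ) * B ^ 2 ≤ ∑ k ∈ t, (h.choose k : ℝ) * (2 * k - h) ^ 2 :=
        sum_le_sum fun k hk => mul_le_mul_of_nonneg_left (hBt k hk) (by positivity)
    _ ≤ ∑ k ∈ range (h + 1), (h.choose k : ℝ) * (2 * k - h) ^ 2 :=
        sum_le_sum_of_subset_of_nonneg ht fun _ _ _ => by positivity

lemma card_le_of_forall_sq_lt {x B : ℝ} (hB : 1 ≤ B) {t : Finset ℕ}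
    (ht : ∀ k ∈ t, (2 * (k : ℝ) - x) ^ 2 < B ^ 2) : (#t : ℝ) ≤ 2 * B := by
  have hsub : t.map Nat.castEmbedding ⊆ Icc ⌈(x - B) / 2⌉ ⌊(x + B) / 2⌋ := by
    intro z hz
    obtain ⟨k, hk, rfl⟩ := mem_map.1 hz
    have := abs_lt.1 (abs_lt_of_sq_lt_sq (ht k hk) (by linarith))
    rw [mem_Icc, Int.ceil_le, Int.le_floor]
    simp only [Nat.castEmbedding_apply, Int.cast_natCast]
    constructor <;> linarith
  have hcard : (#t : ℤ) ≤ max (⌊(x + B) / 2⌋ + 1 - ⌈(x - B) / 2⌉) 0 := by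
    rw [← Int.toNat_eq_max, ← Int.card_Icc, Nat.cast_le, ← card_map (Nat.castEmbedding (R := ℤ))]
    exact card_le_card hsub
  have hcard' : (#t : ℝ) ≤ max ((⌊(x + B) / 2⌋ : ℝ) + 1 - (⌈(x - B) / 2⌉ : ℝ)) 0 := by
    exact_mod_cast hcard
  refine hcard'.trans (max_le ?_ (by linarith))
  linarith [Int.floor_le ((x + B) / 2), Int.le_ceil ((x - B) / 2)]

-- Chebyshev's inequality bounds the terms far from the middle; there are at most `2 * B` others.
lemma sum_choose_lt_le (h : ℕ) {B τ : ℝ} (hB : 1 ≤ B) (hτ : 0 ≤ τ) :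
    ∑ k ∈ range (h + 1) with (h.choose k : ℝ) < τ, (h.choose k : ℝ) ≤
      h * 2 ^ h / B ^ 2 + 2 * B * τ := by
  rw [← sum_filter_add_sum_filter_not _ (fun k : ℕ => B ^ 2 ≤ (2 * (k : ℝ) - h) ^ 2)]
  gcongr
  · exact sum_choose_le_of_forall_sq_le (by linarith)
      ((filter_subset _ _).trans (filter_subset _ _)) fun k hk => (mem_filter.1 hk).2
  · calc _ ≤ ∑ k ∈ range (h + 1) with (h.choose k : ℝ) < τ ∧ ¬ B ^ 2 ≤ (2 * (k : ℝ) - h) ^ 2,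
            τ := by
          rw [filter_filter]
          exact sum_le_sum fun k hk => (mem_filter.1 hk).2.1.le
      _ ≤ 2 * B * τ := by
          rw [sum_const, nsmul_eq_mul]
          gcongr
          exact card_le_of_forall_sq_lt (x := h) hB fun k hk => not_le.1 (mem_filter.1 hk).2.2

end Binomials

section Hypergeometric

variable {α : Type*} [DecidableEq α] (U A : Finset α)

lemma card_filter_card_inter_eq {r w : ℕ} (hw : w ≤ r) :
    #{W ∈ powersetCard r U | #(W ∩ A) = w} =
      (#(U ∩ A)).choose w * (#(U \ A)).choose (r - w) := by
  rw [← card_powersetCard, ← card_powersetCard, ← card_product]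
  refine card_nbij' (fun W => (W ∩ A, W \ A)) (fun p => p.1 ∪ p.2) ?_ ?_ ?_ ?_
  · intro W hW
    have := card_inter_add_card_sdiff W A
    simp only [coe_filter, Set.mem_ofPred_eq, mem_powersetCard, coe_product, Set.mem_prod,
      mem_coe] at hW ⊢
    exact ⟨⟨inter_subset_inter_right hW.1.1, hW.2⟩, sdiff_subset_sdiff hW.1.1 le_rfl, by omega⟩
  · rintro ⟨X, Y⟩ hXY
    simp only [coe_filter, Set.mem_ofPred_eq, mem_powersetCard, coe_product, Set.mem_prod,
      mem_coe] at hXY ⊢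
    obtain ⟨⟨hX, hXc⟩, hY, hYc⟩ := hXY
    have hXY : (X ∪ Y) ∩ A = X := by grind
    have hdisj : Disjoint X Y := disjoint_left.2 (by grind)
    refine ⟨⟨by grind, ?_⟩, by rw [hXY, hXc]⟩
    rw [card_union_of_disjoint hdisj]; omega
  · intro W _
    exact sup_inf_sdiff W A
  · rintro ⟨X, Y⟩ hXY
    simp only [mem_powersetCard, coe_product, Set.mem_prod, mem_coe] at hXY
    exact Prod.ext (by grind) (by grind)

lemma choose_mul_choose_le_card_filter {h w v : ℕ} (hU : #U = 2 * h) (hw : w ≤ h) (hv : v ≤ h)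
    (hUA : #(U ∩ A) = w + v) :
    h.choose w * h.choose v ≤ #{W ∈ powersetCard h U | #(W ∩ A) = w} := by
  have hcard := card_inter_add_card_sdiff U A
  obtain ⟨c, rfl⟩ := Nat.exists_eq_add_of_le hw
  obtain ⟨e, he⟩ := Nat.exists_eq_add_of_le hv
  rw [card_filter_card_inter_eq U A hw, hUA, show #(U \ A) = c + e by omega,
    Nat.add_sub_cancel_left]
  have key := choose_mul_choose_mul_choose_comm w v c e
  rw [← he] at key
  have hmid : (w + c + (w + c)).choose (w + v) ≤ (w + c + (w + c)).choose (w + c) := by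
    rw [← two_mul]
    exact Nat.choose_le_centralBinom _ _
  refine Nat.le_of_mul_le_mul_right ?_ (Nat.choose_pos (by omega) :
    0 < (w + c + (w + c)).choose (w + c))
  rw [← key]
  exact Nat.mul_le_mul_left _ hmid

end Hypergeometric

section Typical

variable {d h : ℕ}

/-- The least size at which a binomial coefficient `h.choose w` counts as typical. The denominator
is chosen so that Chebyshev's inequality leaves at most a `1 / (32 * d)`-fraction of the total
weight `2 ^ h` below the threshold. -/
noncomputable def typicalThreshold (d h : ℕ) : ℝ := 2 ^ h / (1024 * d * √(h * d))

/-- `w` is a typical size for the intersection of a block of `h` points with a halving set, when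
there are `2 * d` blocks. -/
def IsTypical (d h w : ℕ) : Prop := typicalThreshold d h ≤ h.choose w

lemma typicalThreshold_pos (hd : 0 < d) (hh : 0 < h) : 0 < typicalThreshold d h := by
  unfold typicalThreshold; positivity

lemma IsTypical.le (hd : 0 < d) (hh : 0 < h) {w : ℕ} (hw : IsTypical d h w) : w ≤ h := by
  have := Nat.cast_pos.1 ((typicalThreshold_pos hd hh).trans_le hw)
  exact not_lt.1 (mt Nat.choose_eq_zero_of_lt this.ne')

lemma IsTypical.of_abs_le {k w : ℕ} (hk : k ≤ h) (htyp : IsTypical d h k)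
    (hwk : |2 * (w : ℤ) - h| ≤ |2 * (k : ℤ) - h|) : IsTypical d h w := by
  have hw : w ≤ h := by
    have : |2 * (k : ℤ) - h| ≤ h := abs_le.2 ⟨by omega, by omega⟩
    have := abs_le.1 (hwk.trans this)
    omega
  exact htyp.trans (Nat.cast_le.2 (choose_le_choose_of_abs_le hk hw hwk))

open scoped Classical in
lemma sum_choose_not_isTypical_le (hd : 0 < d) (hh : 0 < h) :
    ∑ w ∈ range (h + 1) with ¬ IsTypical d h w, (h.choose w : ℝ) ≤ 2 ^ h / (32 * d) := by
  have hd1 : (1 : ℝ) ≤ d := by exact_mod_cast hd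
  have hh1 : (1 : ℝ) ≤ h := by exact_mod_cast hh
  have hsqrt : √(h * d) ^ 2 = h * d := Real.sq_sqrt (by positivity)
  have hsqrt1 : 1 ≤ √(h * d) := Real.one_le_sqrt.2 (by nlinarith)
  -- With `B = 8 * √(h * d)` the two terms of the bound are equal.
  have chebyshev := sum_choose_lt_le h (B := 8 * √(h * d)) (by linarith)
    (typicalThreshold_pos hd hh).le
  simp only [IsTypical, not_le]
  refine chebyshev.trans_eq ?_
  rw [typicalThreshold, mul_pow, hsqrt]
  field_simp
  norm_num

variable {α : Type*} [Fintype α] [DecidableEq α]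

lemma card_filter_card_inter_mem_le {k : ℕ} (hα : Fintype.card α = 2 * k) (hk : 0 < k)
    {C : Finset α} (hC : #C ≤ k) {T : Finset ℕ} (hT : ∀ w ∈ T, w ≤ k) :
    (#{A ∈ powersetCard k univ | #(C ∩ A) ∈ T} : ℝ) ≤
      (∑ w ∈ T, ((#C).choose w : ℝ)) * (2 * k.centralBinom / 2 ^ #C) := by
  have each (w : ℕ) (hw : w ∈ T) : (#{A ∈ powersetCard k univ | #(C ∩ A) = w} : ℝ) ≤
      (#C).choose w * (2 * k.centralBinom / 2 ^ #C) := by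
    have hcount := card_filter_card_inter_eq univ C (hT w hw)
    rw [univ_inter, card_sdiff_of_subset (subset_univ C), card_univ, hα] at hcount
    simp only [inter_comm C, hcount, Nat.cast_mul]
    gcongr
    rw [le_div_iff₀ (by positivity), mul_comm]
    exact_mod_cast two_pow_mul_choose_le hk hC (k - w)
  calc (#{A ∈ powersetCard k univ | #(C ∩ A) ∈ T} : ℝ)
      = #{A ∈ powersetCard k univ | ∃ w ∈ T, #(C ∩ A) = w} := by
        simp only [exists_eq_right']
    _ ≤ ∑ w ∈ T, (#{A ∈ powersetCard k univ | #(C ∩ A) = w} : ℝ) := by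
        exact_mod_cast card_filter_exists_mem_le _ T fun w A => #(C ∩ A) = w
    _ ≤ (∑ w ∈ T, ((#C).choose w : ℝ)) * (2 * k.centralBinom / 2 ^ #C) := by
        rw [sum_mul]
        exact sum_le_sum each

open scoped Classical in
lemma card_filter_not_isTypical_le (hd : 0 < d) (hh : 0 < h)
    (hα : Fintype.card α = 2 * (d * h)) {C : Finset α} (hC : #C = h) :
    (#{A ∈ powersetCard (d * h) univ | ¬ IsTypical d h #(C ∩ A)} : ℝ) ≤
      (d * h).centralBinom / (16 * d) := by
  have hh' : h ≤ d * h := Nat.le_mul_of_pos_left h hd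
  have hCle (A : Finset α) : #(C ∩ A) < h + 1 :=
    Nat.lt_succ_of_le ((card_le_card inter_subset_left).trans_eq hC)
  calc (#{A ∈ powersetCard (d * h) univ | ¬ IsTypical d h #(C ∩ A)} : ℝ)
      = #{A ∈ powersetCard (d * h) univ |
          #(C ∩ A) ∈ {w ∈ range (h + 1) | ¬ IsTypical d h w}} := by
        simp only [mem_filter, mem_range, hCle, true_and]
    _ ≤ (∑ w ∈ range (h + 1) with ¬ IsTypical d h w, (h.choose w : ℝ)) *
          (2 * (d * h).centralBinom / 2 ^ h) := by
        have := card_filter_card_inter_mem_le hα (by positivity) (hC.trans_le hh')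
          (T := {w ∈ range (h + 1) | ¬ IsTypical d h w}) fun w hw =>
            (mem_range_succ_iff.1 (mem_filter.1 hw).1).trans hh'
        rwa [hC] at this
    _ ≤ 2 ^ h / (32 * d) * (2 * (d * h).centralBinom / 2 ^ h) := by
        gcongr
        exact sum_choose_not_isTypical_le hd hh
    _ = (d * h).centralBinom / (16 * d) := by field_simp; ring

end Typical

section Splitting

variable {d h : ℕ}

/-- A lower bound for the probability that a random half of a set of `2 * h` points meets a fixed
set in a prescribed number of points, if both halves then have typical intersections. -/
noncomputable def hitProb (d h : ℕ) : ℝ := 1 / (2 ^ 20 * d ^ 3 * √h)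

lemma hitProb_nonneg : 0 ≤ hitProb d h := by unfold hitProb; positivity

lemma hitProb_le_one (hd : 0 < d) (hh : 0 < h) : hitProb d h ≤ 1 := by
  have hd1 : (1 : ℝ) ≤ d ^ 3 := one_le_pow₀ (by exact_mod_cast hd)
  have hs : 1 ≤ √(h : ℝ) := Real.one_le_sqrt.2 (by exact_mod_cast hh)
  rw [hitProb, div_le_one (by positivity)]
  nlinarith

lemma centralBinom_mul_sqrt_le (h : ℕ) : (h.centralBinom : ℝ) * √h ≤ 4 ^ h := by
  rw [← pow_le_pow_iff_left₀ (by positivity) (by positivity) two_ne_zero]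
  calc ((h.centralBinom : ℝ) * √h) ^ 2 = (h.centralBinom : ℝ) ^ 2 * h := by
        rw [mul_pow, Real.sq_sqrt (by positivity)]
    _ ≤ (h.centralBinom : ℝ) ^ 2 * (2 * h + 1) := by gcongr; linarith
    _ ≤ 16 ^ h := by exact_mod_cast sq_centralBinom_mul_le h
    _ = (4 ^ h) ^ 2 := by rw [← pow_mul, mul_comm, pow_mul]; norm_num

lemma hitProb_mul_centralBinom_le (hd : 0 < d) (hh : 0 < h) :
    hitProb d h * h.centralBinom ≤ typicalThreshold d h ^ 2 := by
  have hsq : √(h : ℝ) ^ 2 = h := Real.sq_sqrt (by positivity)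
  rw [hitProb, typicalThreshold, div_pow, mul_pow, Real.sq_sqrt (by positivity), ← pow_mul,
    mul_comm h 2, pow_mul, one_div_mul_eq_div, div_le_div_iff₀ (by positivity) (by positivity)]
  calc (h.centralBinom : ℝ) * ((1024 * d) ^ 2 * (h * d))
      = (h.centralBinom * √h) * (2 ^ 20 * d ^ 3 * √h) := by
        linear_combination (-(2 ^ 20 * (h.centralBinom : ℝ) * d ^ 3)) * hsq
    _ ≤ 4 ^ h * (2 ^ 20 * d ^ 3 * √h) := by gcongr; exact centralBinom_mul_sqrt_le h
    _ = (2 ^ 2) ^ h * (2 ^ 20 * d ^ 3 * √h) := by norm_num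

variable {α : Type*} [DecidableEq α]

/-- `A` can be split in every typical way inside `U` by a member of `G`. -/
def SplitsTypically (d h : ℕ) (U : Finset α) (G : Finset (Finset α)) (A : Finset α) : Prop :=
  ∀ w v, w + v = #(U ∩ A) → IsTypical d h w → IsTypical d h v → ∃ W ∈ G, #(W ∩ A) = w

lemma hitProb_mul_card_powersetCard_le (hd : 0 < d) (hh : 0 < h) {U A : Finset α}
    (hU : #U = 2 * h) {w v : ℕ} (hUA : #(U ∩ A) = w + v) (hw : IsTypical d h w)
    (hv : IsTypical d h v) :
    hitProb d h * #(powersetCard h U) ≤ #{W ∈ powersetCard h U | #(W ∩ A) = w} := by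
  rw [card_powersetCard, hU]
  calc hitProb d h * h.centralBinom ≤ typicalThreshold d h ^ 2 := hitProb_mul_centralBinom_le hd hh
    _ ≤ h.choose w * h.choose v := by
        rw [sq]
        exact mul_le_mul hw hv (typicalThreshold_pos hd hh).le (by positivity)
    _ ≤ #{W ∈ powersetCard h U | #(W ∩ A) = w} := by
        exact_mod_cast choose_mul_choose_le_card_filter U A hU (hw.le hd hh) (hv.le hd hh) hUA

open scoped Classical in
lemma exists_splitting_family (hd : 0 < d) (hh : 0 < h) {U : Finset α} (hU : #U = 2 * h)
    (s : Finset (Finset α)) (K : ℕ) :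
    ∃ G ⊆ powersetCard h U, #G ≤ K ∧
      (#{A ∈ s | ¬ SplitsTypically d h U G A} : ℝ) ≤ (1 - hitProb d h) ^ K * ((h + 1) * #s) := by
  set t : Finset (Finset α × ℕ) := {p ∈ s ×ˢ range (h + 1) |
    ∃ v, p.2 + v = #(U ∩ p.1) ∧ IsTypical d h p.2 ∧ IsTypical d h v}
  obtain ⟨G, hG, hGK, hGt⟩ := exists_greedy_cover (s := t) (Ω := powersetCard h U)
    (R := fun p W => #(W ∩ p.1) = p.2) (hitProb_le_one hd hh)
    (powersetCard_nonempty.2 (by omega)) (by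
      rintro ⟨A, w⟩ hp
      obtain ⟨v, hwv, hw, hv⟩ := (mem_filter.1 hp).2
      exact hitProb_mul_card_powersetCard_le hd hh hU hwv.symm hw hv) K
  have unsplit : {A ∈ s | ¬ SplitsTypically d h U G A} ⊆
      ({p ∈ t | ∀ W ∈ G, ¬ #(W ∩ p.1) = p.2}).image Prod.fst := by
    intro A hA
    obtain ⟨hAs, hA⟩ := mem_filter.1 hA
    unfold SplitsTypically at hA
    push Not at hA
    obtain ⟨w, v, hwv, hw, hv, hGA⟩ := hA
    exact mem_image.2 ⟨(A, w), mem_filter.2 ⟨mem_filter.2 ⟨mem_product.2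
      ⟨hAs, mem_range_succ_iff.2 (hw.le hd hh)⟩, v, hwv, hw, hv⟩, hGA⟩, rfl⟩
  have hts : (#t : ℝ) ≤ (h + 1) * #s := by
    have := (card_filter_le _ _ : #t ≤ #(s ×ˢ range (h + 1)))
    rw [card_product, card_range, mul_comm] at this
    exact_mod_cast this
  have hmiss : 0 ≤ (1 - hitProb d h) ^ K := pow_nonneg (sub_nonneg.2 (hitProb_le_one hd hh)) K
  refine ⟨G, hG, hGK, ?_⟩
  calc (#{A ∈ s | ¬ SplitsTypically d h U G A} : ℝ)
      ≤ #{p ∈ t | ∀ W ∈ G, ¬ #(W ∩ p.1) = p.2} := by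
        exact_mod_cast (card_le_card unsplit).trans card_image_le
    _ ≤ (1 - hitProb d h) ^ K * #t := by convert hGt
    _ ≤ (1 - hitProb d h) ^ K * ((h + 1) * #s) := by gcongr

end Splitting

section Steinitz

variable {Γ ι : Type*} [AddCommGroup Γ] [LinearOrder Γ] [IsOrderedAddMonoid Γ] {R : Finset ι}
  {x : ι → Γ} {p M : Γ}

lemma exists_mem_abs_add_le (hR : R.Nonempty) (hx : ∀ a ∈ R, |x a| ≤ M) (hp : |p| ≤ M)
    (hsum : p + ∑ a ∈ R, x a = 0) : ∃ a ∈ R, |p + x a| ≤ M := by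
  rcases le_total 0 p with h0 | h0
  · obtain ⟨a, ha, hxa⟩ := exists_le_of_sum_le hR (f := x) (g := fun _ => 0)
      (by rw [sum_const_zero, ← neg_eq_of_add_eq_zero_right hsum]; exact neg_nonpos.2 h0)
    exact ⟨a, ha, abs_le.2 ⟨(abs_le.1 (hx a ha)).1.trans (le_add_of_nonneg_left h0),
      (add_le_of_nonpos_right hxa).trans (abs_le.1 hp).2⟩⟩
  · obtain ⟨a, ha, hxa⟩ := exists_le_of_sum_le hR (f := fun _ => 0) (g := x)
      (by rw [sum_const_zero, ← neg_eq_of_add_eq_zero_right hsum]; exact neg_nonneg.2 h0)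
    exact ⟨a, ha, abs_le.2 ⟨(abs_le.1 hp).1.trans (le_add_of_nonneg_right hxa),
      (add_le_of_nonpos_left h0).trans (abs_le.1 (hx a ha)).2⟩⟩

lemma exists_enumeration_abs_add_sum_le [Nonempty ι] [DecidableEq ι] (hx : ∀ a ∈ R, |x a| ≤ M)
    (hp : |p| ≤ M) (hsum : p + ∑ a ∈ R, x a = 0) :
    ∃ c : ℕ → ι, (range #R).image c = R ∧ ∀ j ≤ #R, |p + ∑ k ∈ range j, x (c k)| ≤ M := by
  induction hm : #R generalizing R p with
  | zero =>
    rw [card_eq_zero] at hm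
    exact ⟨fun _ => Classical.arbitrary ι, by simp [hm], fun j hj => by
      simpa [Nat.le_zero.1 hj] using hp⟩
  | succ m ih =>
    obtain ⟨a, ha, hpa⟩ := exists_mem_abs_add_le (card_pos.1 (by omega)) hx hp hsum
    obtain ⟨c, hc, hcM⟩ := ih (R := R.erase a) (p := p + x a)
      (fun b hb => hx b (mem_of_mem_erase hb)) hpa (by rw [add_assoc, add_sum_erase R x ha, hsum])
      (by rw [card_erase_of_mem ha, hm, Nat.add_sub_cancel])
    refine ⟨fun k => Nat.casesOn k a c, ?_, fun j hj => ?_⟩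
    · rw [range_add_one', image_insert, map_eq_image, image_image]
      exact (congrArg (insert a) hc).trans (insert_erase ha)
    · cases j with
      | zero => simpa using hp
      | succ j =>
        rw [sum_range_succ', add_comm (∑ k ∈ range j, _), ← add_assoc]
        exact hcM j (by omega)

end Steinitz

section Chain

variable {α : Type*} [DecidableEq α]

/-- Each link `V i` cuts the piece `B i` in two. The remainder `B i \ V i` is completed by the next
link, so that consecutive pieces get chained together. -/
def chain (B V : ℕ → Finset α) (i : ℕ) : Finset α := B i \ V i ∪ V (i + 1)

variable {B V : ℕ → Finset α} {d : ℕ}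

lemma chain_inter (A : Finset α) (i : ℕ) :
    chain B V i ∩ A = chain (fun k => B k ∩ A) (fun k => V k ∩ A) i := by
  grind [chain]

lemma disjoint_chain (hB : Pairwise (Function.onFun Disjoint B)) (hV : ∀ i ≤ d, V i ⊆ B i)
    {i j : ℕ} (hi : i < d) (hj : j < d) (hij : i ≠ j) :
    Disjoint (chain B V i) (chain B V j) := by
  wlog hlt : i < j generalizing i j
  · exact (this hj hi hij.symm (by omega)).symm
  have h1 : Disjoint (B i) (B j) := hB (by omega)
  have h2 : Disjoint (B i) (B (j + 1)) := hB (by omega)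
  have h3 : Disjoint (B (i + 1)) (B (j + 1)) := hB (by omega)
  have h4 : Disjoint (V (i + 1)) (B j \ V j) := by
    rcases (Nat.succ_le_of_lt hlt).eq_or_lt with rfl | hlt
    · exact disjoint_sdiff
    · exact (hB (by omega : i + 1 ≠ j)).mono (hV _ hi) sdiff_subset
  rw [chain, chain, disjoint_union_left, disjoint_union_right, disjoint_union_right]
  exact ⟨⟨h1.mono sdiff_subset sdiff_subset, h2.mono sdiff_subset (hV _ hj)⟩, h4,
    h3.mono (hV _ hi) (hV _ hj)⟩

lemma biUnion_chain (hV : ∀ i ≤ d, V i ⊆ B i) (h0 : V 0 = ∅) (hlast : V d = B d) :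
    (range d).biUnion (chain B V) = (range (d + 1)).biUnion B := by
  ext x
  simp only [mem_biUnion, mem_range, chain, mem_union, mem_sdiff]
  constructor
  · rintro ⟨i, hi, hx | hx⟩
    · exact ⟨i, by omega, hx.1⟩
    · exact ⟨i + 1, by omega, hV _ hi hx⟩
  · rintro ⟨i, hi, hx⟩
    by_cases hxV : x ∈ V i
    · obtain ⟨i, rfl⟩ : ∃ j, i = j + 1 :=
        Nat.exists_eq_succ_of_ne_zero fun hi0 => by simp [hi0, h0] at hxV
      exact ⟨i, by omega, Or.inr hxV⟩
    · have : i ≠ d := by rintro rfl; exact hxV (hlast ▸ hx)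
      exact ⟨i, by omega, Or.inl ⟨hx, hxV⟩⟩

lemma card_chain (hB : Pairwise (Function.onFun Disjoint B)) (hV : ∀ i ≤ d, V i ⊆ B i) {m : ℕ}
    (hcard : ∀ i ≤ d, #(V i) + ∑ k ∈ range i, #(B k) = i * m) {i : ℕ} (hi : i < d) :
    #(chain B V i) = m := by
  have hdisj : Disjoint (B i \ V i) (V (i + 1)) :=
    (hB (by omega : i ≠ i + 1)).mono sdiff_subset (hV _ hi)
  have hcut := card_sdiff_add_card_eq_card (hV i hi.le)
  have hthis := hcard i hi.le
  have hnext := hcard (i + 1) hi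
  rw [sum_range_succ, add_mul, one_mul] at hnext
  rw [chain, card_union_of_disjoint hdisj]
  omega

lemma card_chain_inter (hB : Pairwise (Function.onFun Disjoint B)) (hV : ∀ i ≤ d, V i ⊆ B i)
    {m : ℕ} {A : Finset α}
    (hcard : ∀ i ≤ d, #(V i ∩ A) + ∑ k ∈ range i, #(B k ∩ A) = i * m) {i : ℕ} (hi : i < d) :
    #(chain B V i ∩ A) = m := by
  rw [chain_inter]
  exact card_chain (fun i j hij => (hB hij).mono inter_subset_left inter_subset_left)
    (fun i hi => inter_subset_inter_right (hV i hi)) hcard hi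

/-- The pieces `D 0`, `D 1 ∪ D 2`, `D 3 ∪ D 4`, …; the truncated subtraction makes the first one a
single block. -/
def pairBlocks (D : ℕ → Finset α) (i : ℕ) : Finset α := D (2 * i - 1) ∪ D (2 * i)

variable {D : ℕ → Finset α}

lemma pairwise_disjoint_pairBlocks (hD : Pairwise (Function.onFun Disjoint D)) :
    Pairwise (Function.onFun Disjoint (pairBlocks D)) := by
  intro i j hij
  simp only [Function.onFun, pairBlocks, disjoint_union_left, disjoint_union_right]
  exact ⟨⟨hD (by omega), hD (by omega)⟩, hD (by omega), hD (by omega)⟩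

lemma pairBlocks_inter (A : Finset α) (i : ℕ) :
    pairBlocks D i ∩ A = pairBlocks (fun k => D k ∩ A) i :=
  union_inter_distrib_right _ _ _

lemma card_pairBlocks_succ (hD : Pairwise (Function.onFun Disjoint D)) (i : ℕ) :
    #(pairBlocks D (i + 1)) = #(D (2 * i + 1)) + #(D (2 * i + 2)) :=
  card_union_of_disjoint (hD (by omega))

lemma sum_card_pairBlocks (hD : Pairwise (Function.onFun Disjoint D)) (i : ℕ) :
    ∑ k ∈ range (i + 1), #(pairBlocks D k) = ∑ k ∈ range (2 * i + 1), #(D k) := by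
  induction i with
  | zero => simp [pairBlocks]
  | succ i ih =>
    rw [sum_range_succ, ih, card_pairBlocks_succ hD, Nat.mul_succ,
      sum_range_succ _ (2 * i + 2), sum_range_succ _ (2 * i + 1), add_assoc]

lemma card_pairBlocks_succ_inter (hD : Pairwise (Function.onFun Disjoint D)) (i : ℕ)
    (A : Finset α) :
    #(pairBlocks D (i + 1) ∩ A) = #(D (2 * i + 1) ∩ A) + #(D (2 * i + 2) ∩ A) := by
  rw [pairBlocks_inter]
  exact card_pairBlocks_succ (fun _ _ hij => (hD hij).mono inter_subset_left inter_subset_left) i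

lemma sum_card_pairBlocks_inter (hD : Pairwise (Function.onFun Disjoint D)) (i : ℕ)
    (A : Finset α) :
    ∑ k ∈ range (i + 1), #(pairBlocks D k ∩ A) = ∑ k ∈ range (2 * i + 1), #(D k ∩ A) := by
  simp only [pairBlocks_inter]
  exact sum_card_pairBlocks (fun _ _ hij => (hD hij).mono inter_subset_left inter_subset_left) i

lemma biUnion_pairBlocks (D : ℕ → Finset α) (d : ℕ) :
    (range (d + 1)).biUnion (pairBlocks D) = (range (2 * d + 1)).biUnion D := by
  ext x
  simp only [mem_biUnion, mem_range, pairBlocks, mem_union]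
  constructor
  · rintro ⟨i, hi, hx | hx⟩
    exacts [⟨2 * i - 1, by omega, hx⟩, ⟨2 * i, by omega, hx⟩]
  · rintro ⟨k, hk, hx⟩
    obtain ⟨i, rfl | rfl⟩ := Nat.even_or_odd' k
    exacts [⟨i, by omega, Or.inr hx⟩, ⟨i + 1, by omega, Or.inl hx⟩]

end Chain

section Blocks

variable {α : Type*} [Fintype α] [DecidableEq α]

lemma exists_finpartition_card_eq {m h : ℕ} (hh : 0 < h) (hα : Fintype.card α = m * h) :
    ∃ P : Finpartition (univ : Finset α), (∀ p ∈ P.parts, #p = h) ∧ #P.parts = m := by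
  have hsize : m * h + 0 * (h + 1) = #(univ : Finset α) := by rw [card_univ, hα, zero_mul, add_zero]
  refine ⟨(⊥ : Finpartition univ).equitabilise hsize, fun p hp => ?_,
    Finpartition.card_parts_equitabilise _ hsize hh.ne'⟩
  refine (Finpartition.card_eq_of_mem_parts_equitabilise hp).resolve_right fun hbig => ?_
  have hempty := card_eq_zero.1 (Finpartition.card_filter_equitabilise_big ⊥ hsize)
  exact notMem_empty p (hempty ▸ mem_filter.2 ⟨hp, hbig⟩)

/-- An enumeration `D 0, D 1, …` of the blocks of `P`, continued by empty sets, for which the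
partial sums of the discrepancies `2 * #(D k ∩ A) - h` are bounded by `M`. -/
structure IsBlockSequence (P : Finpartition (univ : Finset α)) (A : Finset α) (h : ℕ) (M : ℤ)
    (D : ℕ → Finset α) : Prop where
  mem_parts : ∀ k < #P.parts, D k ∈ P.parts
  eq_empty : ∀ k, #P.parts ≤ k → D k = ∅
  disjoint : Pairwise (Function.onFun Disjoint D)
  biUnion_eq : (range #P.parts).biUnion D = univ
  abs_sum_le : ∀ j ≤ #P.parts, |2 * ((∑ k ∈ range j, #(D k ∩ A) : ℕ) : ℤ) - j * h| ≤ M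

lemma sum_card_parts_inter (P : Finpartition (univ : Finset α)) (A : Finset α) :
    ∑ p ∈ P.parts, #(p ∩ A) = #A := by
  have hcover : P.parts.biUnion (· ∩ A) = A := by
    rw [← biUnion_inter]
    exact (congrArg (· ∩ A) P.biUnion_parts).trans (univ_inter A)
  have hcard := card_biUnion (s := P.parts) (t := (· ∩ A)) fun p hp q hq hpq =>
    (P.disjoint hp hq hpq).mono inter_subset_left inter_subset_left
  rw [← hcard, hcover]

lemma exists_isBlockSequence {P : Finpartition (univ : Finset α)} {h : ℕ} {M : ℤ} {A : Finset α}
    (hA : 2 * #A = #P.parts * h) (hM0 : 0 ≤ M)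
    (hM : ∀ p ∈ P.parts, |2 * (#(p ∩ A) : ℤ) - h| ≤ M) : ∃ D, IsBlockSequence P A h M D := by
  have hsum : 0 + ∑ p ∈ P.parts, (2 * (#(p ∩ A) : ℤ) - h) = 0 := by
    rw [zero_add, sum_sub_distrib, ← mul_sum, ← Nat.cast_sum, sum_card_parts_inter, sum_const,
      nsmul_eq_mul, sub_eq_zero]
    exact_mod_cast hA
  obtain ⟨c, hc, hcM⟩ := exists_enumeration_abs_add_sum_le hM (by rwa [abs_zero]) hsum
  have hinj : Set.InjOn c (range #P.parts) := card_image_iff.1 (by rw [hc, card_range])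
  have hmem (k : ℕ) (hk : k < #P.parts) : c k ∈ P.parts :=
    hc ▸ mem_image_of_mem c (mem_range.2 hk)
  refine ⟨fun k => if k < #P.parts then c k else ∅, ?_, ?_, ?_, ?_, ?_⟩
  · intro k hk
    rw [if_pos hk]
    exact hmem k hk
  · intro k hk
    exact if_neg (not_lt.2 hk)
  · intro k l hkl
    by_cases hk : k < #P.parts <;> by_cases hl : l < #P.parts <;>
      simp only [Function.onFun, hk, hl, if_true, if_false, disjoint_empty_left,
        disjoint_empty_right]
    exact P.disjoint (hmem k hk) (hmem l hl) fun hkl' =>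
      hkl (hinj (mem_coe.2 (mem_range.2 hk)) (mem_coe.2 (mem_range.2 hl)) hkl')
  · calc (range #P.parts).biUnion (fun k => if k < #P.parts then c k else ∅)
        = (range #P.parts).biUnion (fun k => id (c k)) :=
          biUnion_congr rfl fun k hk => if_pos (mem_range.1 hk)
      _ = ((range #P.parts).image c).biUnion id := image_biUnion.symm
      _ = univ := by rw [hc, P.biUnion_parts]
  · intro j hj
    have := hcM j hj
    rw [zero_add, sum_sub_distrib, ← mul_sum, ← Nat.cast_sum, sum_const, card_range,
      nsmul_eq_mul] at this
    rwa [sum_congr rfl fun k hk => by rw [if_pos ((mem_range.1 hk).trans_le hj)]]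

end Blocks

section Pieces

variable {α : Type*} [Fintype α] [DecidableEq α]

/-- The building blocks of the Galvin family: the blocks of `P`, and for any two blocks the sets
which `G` offers for cutting their union, together with their complements in it. -/
def pieces (P : Finpartition (univ : Finset α)) (G : Finset α → Finset (Finset α)) :
    Finset (Finset α) :=
  P.parts ∪ P.parts.offDiag.biUnion fun p =>
    G (p.1 ∪ p.2) ∪ (G (p.1 ∪ p.2)).image ((p.1 ∪ p.2) \ ·)

variable {P : Finpartition (univ : Finset α)} {G : Finset α → Finset (Finset α)}
  {p q W : Finset α}

lemma mem_pieces_of_mem_parts (hp : p ∈ P.parts) : p ∈ pieces P G := mem_union_left _ hp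

lemma mem_pieces_of_mem_cuts (hp : p ∈ P.parts) (hq : q ∈ P.parts) (hpq : p ≠ q)
    (hW : W ∈ G (p ∪ q)) : W ∈ pieces P G :=
  mem_union_right _ (mem_biUnion.2 ⟨(p, q), mem_offDiag.2 ⟨hp, hq, hpq⟩, mem_union_left _ hW⟩)

lemma union_sdiff_mem_pieces (hp : p ∈ P.parts) (hq : q ∈ P.parts) (hpq : p ≠ q)
    (hW : W ∈ G (p ∪ q)) : (p ∪ q) \ W ∈ pieces P G :=
  mem_union_right _ (mem_biUnion.2 ⟨(p, q), mem_offDiag.2 ⟨hp, hq, hpq⟩,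
    mem_union_right _ (mem_image_of_mem ((p ∪ q) \ ·) hW)⟩)

lemma card_pieces_le {K : ℕ} (hG : ∀ U, #(G U) ≤ K) :
    #(pieces P G) ≤ #P.parts + #P.parts ^ 2 * (2 * K) := by
  refine (card_union_le _ _).trans (add_le_add_right ?_ _)
  have each (p : Finset α × Finset α) :
      #(G (p.1 ∪ p.2) ∪ (G (p.1 ∪ p.2)).image ((p.1 ∪ p.2) \ ·)) ≤ 2 * K := by
    rw [two_mul]
    exact (card_union_le _ _).trans (add_le_add (hG _) (card_image_le.trans (hG _)))
  refine (card_biUnion_le_card_mul _ _ _ fun p _ => each p).trans (Nat.mul_le_mul_right _ ?_)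
  rw [offDiag_card, sq]
  exact Nat.sub_le _ _

end Pieces

section Links

variable {α : Type*} [DecidableEq α]

/-- `V` is a possible `i`-th link for the pieces `B 0, …, B d`, each set of the resulting chain
having `2 * h` elements, `h` of them in `A`, and being a union of two members of `Q`. -/
structure IsLink (Q : Finset (Finset α)) (B : ℕ → Finset α) (A : Finset α) (h d i : ℕ)
    (V : Finset α) : Prop where
  subset : V ⊆ B i
  eq_empty : i = 0 → V = ∅
  eq_last : i = d → V = B d
  mem : 0 < i → V ∈ Q
  sdiff_mem : i < d → B i \ V ∈ Q
  card_add : #V + ∑ k ∈ range i, #(B k) = i * (2 * h)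
  card_inter_add : #(V ∩ A) + ∑ k ∈ range i, #(B k ∩ A) = i * h

lemma exists_chain_of_exists_isLink {Q : Finset (Finset α)} {B : ℕ → Finset α} {A : Finset α}
    {h d : ℕ} (hB : Pairwise (Function.onFun Disjoint B))
    (hlink : ∀ i ≤ d, ∃ V, IsLink Q B A h d i V) :
    ∃ S : ℕ → Finset α, (∀ i < d, ∃ X ∈ Q, ∃ Y ∈ Q, X ∪ Y = S i) ∧ (∀ i < d, #(S i) = 2 * h) ∧
      (∀ i < d, #(S i ∩ A) = h) ∧ (∀ i < d, ∀ j < d, i ≠ j → Disjoint (S i) (S j)) ∧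
      (range d).biUnion S = (range (d + 1)).biUnion B := by
  choose! V hV using hlink
  have hsub (i : ℕ) (hi : i ≤ d) : V i ⊆ B i := (hV i hi).subset
  exact ⟨chain B V,
    fun i hi => ⟨_, (hV i hi.le).sdiff_mem hi, _, (hV (i + 1) hi).mem i.succ_pos, rfl⟩,
    fun i hi => card_chain hB hsub (fun k hk => (hV k hk).card_add) hi,
    fun i hi => card_chain_inter hB hsub (fun k hk => (hV k hk).card_inter_add) hi,
    fun i hi j hj hij => disjoint_chain hB hsub hi hj hij,
    biUnion_chain hsub ((hV 0 d.zero_le).eq_empty rfl) ((hV d le_rfl).eq_last rfl)⟩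

end Links

section BlockLinks

variable {α : Type*} [Fintype α] [DecidableEq α] {P : Finpartition (univ : Finset α)}
  {G : Finset α → Finset (Finset α)} {A : Finset α} {d h : ℕ} {M : ℤ} {D : ℕ → Finset α}

lemma IsBlockSequence.sum_card_inter (hD : IsBlockSequence P A h M D) (C : Finset α) :
    ∑ k ∈ range #P.parts, #(D k ∩ C) = #C := by
  have hcard := card_biUnion (s := range #P.parts) (t := (D · ∩ C)) fun k _ l _ hkl =>
    (hD.disjoint hkl).mono inter_subset_left inter_subset_left
  rw [← hcard, ← biUnion_inter, hD.biUnion_eq, univ_inter]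

lemma IsBlockSequence.sum_card (hD : IsBlockSequence P A h M D) (hP : ∀ p ∈ P.parts, #p = h)
    {j : ℕ} (hj : j ≤ #P.parts) : ∑ k ∈ range j, #(D k) = j * h := by
  rw [sum_congr rfl fun k hk => hP _ (hD.mem_parts k ((mem_range.1 hk).trans_le hj)), sum_const,
    card_range, smul_eq_mul]

lemma IsBlockSequence.ne (hD : IsBlockSequence P A h M D) {k l : ℕ} (hk : k < #P.parts)
    (hkl : k ≠ l) : D k ≠ D l :=
  (hD.disjoint hkl).ne (P.ne_bot (hD.mem_parts k hk))

lemma IsBlockSequence.isLink_zero (hD : IsBlockSequence P A h M D) (hP : 0 < #P.parts)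
    (hd : 0 < d) : IsLink (pieces P G) (pairBlocks D) A h d 0 ∅ where
  subset := empty_subset _
  eq_empty _ := rfl
  eq_last h0 := absurd h0 hd.ne
  mem h0 := absurd h0 (lt_irrefl 0)
  sdiff_mem _ := by
    rw [sdiff_empty, pairBlocks, union_self]
    exact mem_pieces_of_mem_parts (hD.mem_parts 0 hP)
  card_add := by simp
  card_inter_add := by simp

lemma IsBlockSequence.isLink_last (hD : IsBlockSequence P A h M D)
    (hP : ∀ p ∈ P.parts, #p = h) (hPd : #P.parts = 2 * d) (hd : 0 < d) (hA : #A = d * h) :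
    IsLink (pieces P G) (pairBlocks D) A h d d (pairBlocks D d) where
  subset := Subset.rfl
  eq_empty h0 := absurd h0 hd.ne'
  eq_last _ := rfl
  mem _ := by
    rw [pairBlocks, hD.eq_empty (2 * d) hPd.le, union_empty]
    exact mem_pieces_of_mem_parts (hD.mem_parts _ (by omega))
  sdiff_mem hdd := absurd hdd (lt_irrefl d)
  card_add := by
    rw [add_comm, ← sum_range_succ (fun k => #(pairBlocks D k)), sum_card_pairBlocks hD.disjoint,
      sum_range_succ, hD.eq_empty (2 * d) hPd.le, hD.sum_card hP hPd.ge, card_empty]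
    ring
  card_inter_add := by
    rw [add_comm, ← sum_range_succ (fun k => #(pairBlocks D k ∩ A)),
      sum_card_pairBlocks_inter hD.disjoint, sum_range_succ, hD.eq_empty (2 * d) hPd.le,
      ← hPd, hD.sum_card_inter, empty_inter, card_empty, hA, add_zero]

-- `T` and `T + b` are the numbers of points of `A` before and after a pair of blocks. A link with
-- `v` points of `A` brings the count from `T` to the required `(i + 1) * h`.
lemma exists_add_eq_of_abs_le {T b i : ℕ} (hM : M ≤ h)
    (hT : |2 * (T : ℤ) - (2 * i + 1) * h| ≤ M)
    (hTb : |2 * ((T + b : ℕ) : ℤ) - (2 * i + 3) * h| ≤ M) :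
    ∃ v w : ℕ, T + v = (i + 1) * h ∧ v + w = b ∧ |2 * (v : ℤ) - h| ≤ M ∧ |2 * (w : ℤ) - h| ≤ M := by
  push_cast at hTb
  obtain ⟨v, hv⟩ : ∃ v : ℕ, (i + 1) * h = T + v := by
    refine Nat.exists_eq_add_of_le ?_
    zify
    linarith [(abs_le.1 hT).2]
  obtain ⟨w, hw⟩ : ∃ w : ℕ, b = v + w := by
    refine Nat.exists_eq_add_of_le ?_
    zify at hv ⊢
    linarith [(abs_le.1 hTb).1]
  refine ⟨v, w, hv.symm, hw.symm, ?_, ?_⟩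
  · rw [← abs_neg]
    convert hT using 2
    zify at hv
    linear_combination 2 * hv
  · convert hTb using 2
    zify at hv hw
    linear_combination 2 * hv - 2 * hw

lemma IsBlockSequence.exists_isLink_succ (hD : IsBlockSequence P A h M D)
    (hP : ∀ p ∈ P.parts, #p = h) (hPd : #P.parts = 2 * d) (hM : M ≤ h)
    (htyp : ∀ w : ℕ, |2 * (w : ℤ) - h| ≤ M → IsTypical d h w)
    (hG : ∀ U, G U ⊆ powersetCard h U)
    (hsplit : ∀ p ∈ P.parts, ∀ q ∈ P.parts, p ≠ q → SplitsTypically d h (p ∪ q) (G (p ∪ q)) A)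
    {i : ℕ} (hi : i + 1 < d) :
    ∃ V, IsLink (pieces P G) (pairBlocks D) A h d (i + 1) V := by
  have hp := hD.mem_parts (2 * i + 1) (by omega)
  have hq := hD.mem_parts (2 * i + 2) (by omega)
  have hpq : D (2 * i + 1) ≠ D (2 * i + 2) := hD.ne (by omega) (by omega)
  have hbefore := hD.abs_sum_le (2 * i + 1) (by omega)
  have hafter := hD.abs_sum_le (2 * i + 3) (by omega)
  rw [sum_range_succ _ (2 * i + 2), sum_range_succ _ (2 * i + 1), add_assoc,
    ← card_pairBlocks_succ_inter hD.disjoint] at hafter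
  have hcard := hD.sum_card hP (j := 2 * i + 1) (by omega)
  obtain ⟨v, w, hv, hw, hvM, hwM⟩ := exists_add_eq_of_abs_le hM (by exact_mod_cast hbefore)
    (by exact_mod_cast hafter)
  obtain ⟨V, hVG, hVA⟩ := hsplit _ hp _ hq hpq v w hw (htyp v hvM) (htyp w hwM)
  obtain ⟨hVU, hVh⟩ := mem_powersetCard.1 (hG _ hVG)
  exact ⟨V, {
    subset := hVU
    eq_empty := fun h0 => absurd h0 (Nat.succ_ne_zero i)
    eq_last := fun hlast => absurd hlast hi.ne
    mem := fun _ => mem_pieces_of_mem_cuts hp hq hpq hVG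
    sdiff_mem := fun _ => union_sdiff_mem_pieces hp hq hpq hVG
    card_add := by rw [sum_card_pairBlocks hD.disjoint, hVh, hcard]; ring
    card_inter_add := by rw [sum_card_pairBlocks_inter hD.disjoint, hVA, add_comm]; exact hv }⟩

end BlockLinks

section Handling

open scoped FinsetFamily

variable {α : Type*} [Fintype α] [DecidableEq α] {P : Finpartition (univ : Finset α)}
  {G : Finset α → Finset (Finset α)} {A : Finset α} {d h : ℕ}

lemma exists_isBlockSequence_of_isTypical (hP : ∀ p ∈ P.parts, #p = h)
    (hne : P.parts.Nonempty) (hA : 2 * #A = #P.parts * h)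
    (htyp : ∀ p ∈ P.parts, IsTypical d h #(p ∩ A)) :
    ∃ M : ℤ, M ≤ h ∧ (∀ w : ℕ, |2 * (w : ℤ) - h| ≤ M → IsTypical d h w) ∧
      ∃ D, IsBlockSequence P A h M D := by
  obtain ⟨p, hp, hmax⟩ := P.parts.exists_max_image (fun p => |2 * (#(p ∩ A) : ℤ) - h|) hne
  have hph : #(p ∩ A) ≤ h := (card_le_card inter_subset_left).trans_eq (hP p hp)
  exact ⟨_, abs_le.2 ⟨by omega, by omega⟩, fun w hw => (htyp p hp).of_abs_le hph hw,
    exists_isBlockSequence hA (abs_nonneg _) hmax⟩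

lemma exists_balanced_partition (hd : 0 < d) (hP : ∀ p ∈ P.parts, #p = h)
    (hPd : #P.parts = 2 * d) (hA : #A = d * h) (htyp : ∀ p ∈ P.parts, IsTypical d h #(p ∩ A))
    (hG : ∀ U, G U ⊆ powersetCard h U)
    (hsplit : ∀ p ∈ P.parts, ∀ q ∈ P.parts, p ≠ q → SplitsTypically d h (p ∪ q) (G (p ∪ q)) A) :
    ∃ S : ℕ → Finset α, (∀ i < d, S i ∈ (pieces P G ⊻ pieces P G) # (2 * h)) ∧
      (∀ i < d, #(S i ∩ A) = h) ∧ (∀ i < d, ∀ j < d, i ≠ j → Disjoint (S i) (S j)) ∧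
      (range d).biUnion S = univ := by
  obtain ⟨M, hM, hMtyp, D, hD⟩ := exists_isBlockSequence_of_isTypical hP
    (card_pos.1 (by omega)) (by rw [hA, hPd, mul_assoc]) htyp
  obtain ⟨S, hSmem, hScard, hSA, hSdisj, hScover⟩ :=
    exists_chain_of_exists_isLink (Q := pieces P G) (A := A) (h := h) (d := d)
      (pairwise_disjoint_pairBlocks hD.disjoint) fun i hi => by
        rcases hi.eq_or_lt with rfl | hi
        · exact ⟨_, hD.isLink_last hP hPd hd hA⟩
        · cases i with
          | zero => exact ⟨_, hD.isLink_zero (by omega) hd⟩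
          | succ i => exact hD.exists_isLink_succ hP hPd hM hMtyp hG hsplit hi
  refine ⟨S, fun i hi => mem_slice.2 ⟨mem_sups.2 (hSmem i hi), hScard i hi⟩, hSA, hSdisj, ?_⟩
  rw [hScover, biUnion_pairBlocks, range_add_one, biUnion_insert,
    hD.eq_empty (2 * d) hPd.le, empty_union, ← hPd, hD.biUnion_eq]

lemma isHandledBy_of_splitsTypically {n : ℕ} {P : Finpartition (univ : Finset (Fin n))}
    {G : Finset (Fin n) → Finset (Finset (Fin n))} {A : Finset (Fin n)}
    (hd : 0 < d) (hP : ∀ p ∈ P.parts, #p = h) (hPd : #P.parts = 2 * d) (hA : #A = d * h)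
    (htyp : ∀ p ∈ P.parts, IsTypical d h #(p ∩ A)) (hG : ∀ U, G U ⊆ powersetCard h U)
    (hsplit : ∀ p ∈ P.parts, ∀ q ∈ P.parts, p ≠ q → SplitsTypically d h (p ∪ q) (G (p ∪ q)) A) :
    IsHandledBy d ((pieces P G ⊻ pieces P G) # (2 * h)) A := by
  obtain ⟨S, hSmem, hSA, hSdisj, hScover⟩ :=
    exists_balanced_partition hd hP hPd hA htyp hG hsplit
  refine ⟨fun i => S i, fun i => hSmem i i.2,
    fun i j hij => hSdisj i i.2 j j.2 (Fin.val_injective.ne hij), ?_, fun i => ?_⟩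
  · refine eq_univ_iff_forall.2 fun x => ?_
    obtain ⟨i, hi, hx⟩ := mem_biUnion.1 (hScover ▸ mem_univ x)
    exact mem_biUnion.2 ⟨⟨i, mem_range.1 hi⟩, mem_univ _, hx⟩
  · rw [BalancedOn, hSA i i.2, (mem_slice.1 (hSmem i i.2)).2]

end Handling

section HalfFamily

open scoped FinsetFamily

variable {α : Type*} [DecidableEq α] {d h : ℕ}

open scoped Classical in
lemma exists_splitting_families (hd : 0 < d) (hh : 0 < h) (s : Finset (Finset α)) (K : ℕ) :
    ∃ G : Finset α → Finset (Finset α), (∀ U, G U ⊆ powersetCard h U) ∧ (∀ U, #(G U) ≤ K) ∧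
      ∀ U, #U = 2 * h → (#{A ∈ s | ¬ SplitsTypically d h U (G U) A} : ℝ) ≤
        (1 - hitProb d h) ^ K * ((h + 1) * #s) := by
  have each (U : Finset α) : ∃ G ⊆ powersetCard h U, #G ≤ K ∧ (#U = 2 * h →
      (#{A ∈ s | ¬ SplitsTypically d h U G A} : ℝ) ≤ (1 - hitProb d h) ^ K * ((h + 1) * #s)) := by
    by_cases hU : #U = 2 * h
    · simpa only [hU, forall_const] using exists_splitting_family hd hh hU s K
    · exact ⟨∅, empty_subset _, by simp, fun hU' => absurd hU' hU⟩
  choose G hG hGK hGs using each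
  exact ⟨G, hG, hGK, hGs⟩

variable [Fintype α] {P : Finpartition (univ : Finset α)}

open scoped Classical in
lemma card_filter_exists_not_isTypical_le (hd : 0 < d) (hh : 0 < h)
    (hα : Fintype.card α = 2 * (d * h)) (hP : ∀ p ∈ P.parts, #p = h) (hPd : #P.parts = 2 * d) :
    (#{A ∈ powersetCard (d * h) univ | ∃ p ∈ P.parts, ¬ IsTypical d h #(p ∩ A)} : ℝ) ≤
      (d * h).centralBinom / 8 :=
  calc _ ≤ ∑ p ∈ P.parts,
            (#{A ∈ powersetCard (d * h) univ | ¬ IsTypical d h #(p ∩ A)} : ℝ) := by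
        exact_mod_cast card_filter_exists_mem_le _ P.parts fun p A => ¬ IsTypical d h #(p ∩ A)
    _ ≤ ∑ _p ∈ P.parts, ((d * h).centralBinom / (16 * d) : ℝ) :=
        sum_le_sum fun p hp => card_filter_not_isTypical_le hd hh hα (hP p hp)
    _ = (d * h).centralBinom / 8 := by
        rw [sum_const, hPd, nsmul_eq_mul]
        push_cast
        field_simp
        ring

open scoped Classical in
lemma card_filter_exists_not_splitsTypically_le {G : Finset α → Finset (Finset α)}
    {s : Finset (Finset α)} {b : ℝ} (hb : 0 ≤ b) (hP : ∀ p ∈ P.parts, #p = h)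
    (hG : ∀ U, #U = 2 * h → (#{A ∈ s | ¬ SplitsTypically d h U (G U) A} : ℝ) ≤ b) :
    (#{A ∈ s | ∃ e ∈ P.parts.offDiag, ¬ SplitsTypically d h (e.1 ∪ e.2) (G (e.1 ∪ e.2)) A} : ℝ) ≤
      #P.parts ^ 2 * b := by
  have each (e : Finset α × Finset α) (he : e ∈ P.parts.offDiag) :
      (#{A ∈ s | ¬ SplitsTypically d h (e.1 ∪ e.2) (G (e.1 ∪ e.2)) A} : ℝ) ≤ b := by
    obtain ⟨hp, hq, hpq⟩ := mem_offDiag.1 he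
    have hdisj : Disjoint e.1 e.2 := P.disjoint hp hq hpq
    exact hG _ (by rw [card_union_of_disjoint hdisj, hP _ hp, hP _ hq, two_mul])
  have hpairs : (#P.parts.offDiag : ℝ) ≤ #P.parts ^ 2 := by
    rw [offDiag_card, sq]
    exact_mod_cast Nat.sub_le _ _
  calc _ ≤ ∑ e ∈ P.parts.offDiag,
            (#{A ∈ s | ¬ SplitsTypically d h (e.1 ∪ e.2) (G (e.1 ∪ e.2)) A} : ℝ) := by
        exact_mod_cast card_filter_exists_mem_le _ P.parts.offDiag
          fun e A => ¬ SplitsTypically d h (e.1 ∪ e.2) (G (e.1 ∪ e.2)) A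
    _ ≤ #P.parts.offDiag * b := by
        rw [← nsmul_eq_mul]
        exact sum_le_card_nsmul _ _ _ each
    _ ≤ #P.parts ^ 2 * b := by gcongr

open scoped Classical in
lemma one_half_mul_card_le_card_filter_isHandledBy {n : ℕ}
    {P : Finpartition (univ : Finset (Fin n))}
    {G : Finset (Fin n) → Finset (Finset (Fin n))} (hd : 0 < d) (hh : 0 < h)
    (hn : n = 2 * (d * h)) (hP : ∀ p ∈ P.parts, #p = h) (hPd : #P.parts = 2 * d)
    (hG : ∀ U, G U ⊆ powersetCard h U)
    (hunsplit : (#{A ∈ powersetCard (d * h) univ | ∃ e ∈ P.parts.offDiag,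
      ¬ SplitsTypically d h (e.1 ∪ e.2) (G (e.1 ∪ e.2)) A} : ℝ) ≤ (d * h).centralBinom / 4) :
    1 / 2 * ((d * h).centralBinom : ℝ) ≤ #{A ∈ powersetCard (d * h) univ |
      IsHandledBy d ((pieces P G ⊻ pieces P G) # (2 * h)) A} := by
  have hcard : Fintype.card (Fin n) = 2 * (d * h) := (Fintype.card_fin n).trans hn
  have hatypical := card_filter_exists_not_isTypical_le hd hh hcard hP hPd
  set s := powersetCard (d * h) (univ : Finset (Fin n))
  have hs : #s = (d * h).centralBinom := by rw [card_powersetCard, card_univ, hcard]; rfl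
  set handled := {A ∈ s | IsHandledBy d ((pieces P G ⊻ pieces P G) # (2 * h)) A}
  set atypical := {A ∈ s | ∃ p ∈ P.parts, ¬ IsTypical d h #(p ∩ A)}
  set unsplit := {A ∈ s | ∃ e ∈ P.parts.offDiag,
    ¬ SplitsTypically d h (e.1 ∪ e.2) (G (e.1 ∪ e.2)) A}
  have hcover : s ⊆ handled ∪ (atypical ∪ unsplit) := by
    intro A hA
    by_contra hAnot
    simp only [mem_union, mem_filter, hA, true_and, not_or, not_exists, not_and, not_not,
      handled, atypical, unsplit, mem_offDiag, Prod.forall] at hAnot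
    obtain ⟨hunhandled, htyp, hsplit⟩ := hAnot
    exact hunhandled (isHandledBy_of_splitsTypically hd hP hPd (mem_powersetCard.1 hA).2 htyp hG
      fun p hp q hq hpq => hsplit p q ⟨hp, hq, hpq⟩)
  have hcount : ((d * h).centralBinom : ℝ) ≤ #handled + (#atypical + #unsplit) := by
    rw [← hs]
    exact_mod_cast (card_le_card hcover).trans
      ((card_union_le _ _).trans (add_le_add_right (card_union_le _ _) _))
  linarith [(Nat.cast_nonneg _ : (0 : ℝ) ≤ (d * h).centralBinom)]

open scoped Classical in
lemma exists_family_handling_half {n K : ℕ} (hd : 0 < d) (hh : 0 < h) (hn : n = 2 * (d * h))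
    (hK : (1 - hitProb d h) ^ K * (16 * d ^ 2 * (h + 1)) ≤ 1) :
    ∃ F ⊆ powersetCard (2 * h) (univ : Finset (Fin n)), #F ≤ (2 * d + 8 * d ^ 2 * K) ^ 2 ∧
      1 / 2 * ((d * h).centralBinom : ℝ) ≤
        #{A ∈ powersetCard (d * h) univ | IsHandledBy d F A} := by
  have hcard : Fintype.card (Fin n) = 2 * (d * h) := (Fintype.card_fin n).trans hn
  obtain ⟨P, hP, hPd⟩ := exists_finpartition_card_eq hh (hcard.trans (mul_assoc 2 d h).symm)
  set s := powersetCard (d * h) (univ : Finset (Fin n))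
  have hs : #s = (d * h).centralBinom := by rw [card_powersetCard, card_univ, hcard]; rfl
  obtain ⟨G, hG, hGK, hGs⟩ := exists_splitting_families hd hh s K
  have hpieces : #(pieces P G) ≤ 2 * d + 8 * d ^ 2 * K :=
    (card_pieces_le hGK).trans_eq (by rw [hPd]; ring)
  refine ⟨(pieces P G ⊻ pieces P G) # (2 * h), fun S hS =>
    mem_powersetCard.2 ⟨subset_univ S, (mem_slice.1 hS).2⟩, ?_,
    one_half_mul_card_le_card_filter_isHandledBy hd hh hn hP hPd hG ?_⟩
  · rw [sq]
    exact (card_le_card slice_subset).trans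
      ((card_sups_le _ _).trans (Nat.mul_le_mul hpieces hpieces))
  · have hmiss : 0 ≤ (1 - hitProb d h) ^ K := pow_nonneg (sub_nonneg.2 (hitProb_le_one hd hh)) K
    calc _ ≤ (#P.parts : ℝ) ^ 2 * ((1 - hitProb d h) ^ K * ((h + 1) * #s)) :=
          card_filter_exists_not_splitsTypically_le (by positivity) hP hGs
      _ = (1 - hitProb d h) ^ K * (16 * d ^ 2 * (h + 1)) * ((d * h).centralBinom / 4) := by
          rw [hPd, hs]; push_cast; ring
      _ ≤ 1 * ((d * h).centralBinom / 4) := by gcongr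
      _ = (d * h).centralBinom / 4 := one_mul _

end HalfFamily

section Symmetrization

variable {Γ X : Type*} [Group Γ] [MulAction Γ X] [MulAction.IsPretransitive Γ X]
  [Fintype X] (p : X → Prop) [DecidablePred p]

variable (Γ) in
lemma card_mul_card_filter_smul_eq [Fintype Γ] (x : X) :
    Fintype.card X * #{g : Γ | p (g • x)} = Fintype.card Γ * #{y | p y} := by
  have hconst (y : X) : #{g : Γ | p (g • y)} = #{g : Γ | p (g • x)} := by
    obtain ⟨k, rfl⟩ := MulAction.exists_smul_eq Γ x y
    exact card_equiv (Equiv.mulRight k) fun g => by simp [mul_smul]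
  have hshift (g : Γ) : #{y | p (g • y)} = #{y | p y} :=
    card_equiv (MulAction.toPerm g) fun y => by simp
  have double_count := sum_card_bipartiteAbove_eq_sum_card_bipartiteBelow
    (fun (y : X) (g : Γ) => p (g • y)) (s := univ) (t := univ)
  simpa only [bipartiteAbove, bipartiteBelow, hconst, hshift, sum_const, smul_eq_mul,
    card_univ] using double_count

variable {p} in
variable (Γ) in
lemma exists_forall_exists_smul [Finite Γ] {q : ℝ} (hq1 : q ≤ 1)
    (hq : q * Fintype.card X ≤ #{y | p y}) {K : ℕ} (hK : (1 - q) ^ K * Fintype.card X < 1) :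
    ∃ T : Finset Γ, #T ≤ K ∧ ∀ x : X, ∃ g ∈ T, p (g • x) := by
  have := Fintype.ofFinite Γ
  obtain ⟨T, -, hTK, hT⟩ := exists_greedy_cover (s := (univ : Finset X)) (Ω := (univ : Finset Γ))
    (R := fun x g => p (g • x)) hq1 univ_nonempty (fun x _ => by
      have hX : (0 : ℝ) < Fintype.card X := by exact_mod_cast Fintype.card_pos_iff.2 ⟨x⟩
      have hcount : (Fintype.card X * #{g : Γ | p (g • x)} : ℝ) = Fintype.card Γ * #{y | p y} := by
        exact_mod_cast card_mul_card_filter_smul_eq Γ p x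
      refine le_of_mul_le_mul_left ?_ hX
      rw [hcount, card_univ]
      calc (Fintype.card X * (q * Fintype.card Γ) : ℝ)
          = Fintype.card Γ * (q * Fintype.card X) := by ring
        _ ≤ Fintype.card Γ * #{y | p y} := by gcongr) K
  have hnone : #{x : X | ∀ g ∈ T, ¬ p (g • x)} = 0 :=
    Nat.lt_one_iff.1 (by exact_mod_cast hT.trans_lt hK)
  refine ⟨T, hTK, fun x => ?_⟩
  by_contra! hx
  exact notMem_empty x (card_eq_zero.1 hnone ▸ mem_filter.2 ⟨mem_univ x, hx⟩)

end Symmetrization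

section Galvin

open scoped Pointwise

variable {n d : ℕ} {F F' : Finset (Finset (Fin n))} {A : Finset (Fin n)}

lemma IsHandledBy.mono (hA : IsHandledBy d F A) (hF : F ⊆ F') : IsHandledBy d F' A := by
  obtain ⟨S, hS, hpartition⟩ := hA
  exact ⟨S, fun i => hF (hS i), hpartition⟩

lemma IsHandledBy.smul (hA : IsHandledBy d F A) (σ : Equiv.Perm (Fin n)) :
    IsHandledBy d (σ • F) (σ • A) := by
  obtain ⟨S, hS, hdisj, hcover, hbal⟩ := hA
  refine ⟨fun i => σ • S i, fun i => smul_mem_smul_finset (hS i),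
    fun i j hij => ?_, eq_univ_iff_forall.2 fun x => ?_, fun i => ?_⟩
  · rw [disjoint_iff_inter_eq_empty, ← smul_finset_inter,
      disjoint_iff_inter_eq_empty.1 (hdisj i j hij), smul_finset_empty]
  · obtain ⟨i, hi, hx⟩ := mem_biUnion.1 (hcover ▸ mem_univ (σ⁻¹ • x))
    exact mem_biUnion.2 ⟨i, hi, inv_smul_mem_iff.1 hx⟩
  · rw [BalancedOn, ← smul_finset_inter, card_smul_finset, card_smul_finset, hbal i]

lemma IsGalvinFamily.mono (hF : IsGalvinFamily d F) (hFF' : F ⊆ F')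
    (hF' : F' ⊆ powersetCard (n / d) univ) : IsGalvinFamily d F' :=
  ⟨hF', fun A hA => (hF.2 A hA).mono hFF'⟩

lemma IsGalvinFamily.card_le (hF : IsGalvinFamily d F) : #F ≤ n.choose (n / d) := by
  simpa only [card_powersetCard, card_univ, Fintype.card_fin] using card_le_card hF.1

lemma IsGalvinFamily.exists_card_eq (hF : IsGalvinFamily d F) (m : ℕ) :
    ∃ F' : Finset (Finset (Fin n)), IsGalvinFamily d F' ∧
      #F' = max #F (min m (n.choose (n / d))) := by
  obtain ⟨F', hFF', hF', hcard⟩ := exists_subsuperset_card_eq hF.1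
    (n := max #F (min m (n.choose (n / d)))) (le_max_left _ _) (by
      rw [card_powersetCard, card_univ, Fintype.card_fin]
      exact max_le hF.card_le (min_le_right _ _))
  exact ⟨F', hF.mono hFF' hF', hcard⟩

lemma card_filter_powersetCard {α : Type*} [Fintype α] (k : ℕ)
    (p : Finset α → Prop) [DecidablePred p] :
    #{A : Set.powersetCard α k | p A} = #{A ∈ powersetCard k univ | p A} := by
  rw [← card_map (Function.Embedding.subtype _)]
  congr 1
  ext A
  simp [mem_powersetCard, Set.powersetCard.mem_iff, and_comm]

open scoped Classical in
lemma exists_isGalvinFamily_of_half (hF : F ⊆ powersetCard (n / d) univ)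
    (hhalf : 1 / 2 * (n.choose (n / 2) : ℝ) ≤
      #{A ∈ powersetCard (n / 2) univ | IsHandledBy d F A}) :
    ∃ F' : Finset (Finset (Fin n)), IsGalvinFamily d F' ∧ #F' ≤ (n + 1) * #F := by
  have hX : Fintype.card (Set.powersetCard (Fin n) (n / 2)) = n.choose (n / 2) := by
    rw [← Nat.card_eq_fintype_card, Set.powersetCard.card, Nat.card_fin]
  have hsmall : (1 - 1 / 2 : ℝ) ^ (n + 1) * n.choose (n / 2) < 1 := by
    have hchoose : (n.choose (n / 2) : ℝ) ≤ 2 ^ n := by exact_mod_cast Nat.choose_le_two_pow n _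
    calc (1 - 1 / 2 : ℝ) ^ (n + 1) * n.choose (n / 2) ≤ (1 - 1 / 2 : ℝ) ^ (n + 1) * 2 ^ n := by
          gcongr
      _ = (1 / 2 * 2) ^ n * (1 / 2) := by rw [mul_pow, pow_succ]; ring
      _ < 1 := by norm_num
  have := Set.powersetCard.isPretransitive (α := Fin n) (n := n / 2)
  obtain ⟨T, hTn, hT⟩ := exists_forall_exists_smul (Equiv.Perm (Fin n))
    (p := fun A : Set.powersetCard (Fin n) (n / 2) => IsHandledBy d F A) (q := 1 / 2)
    (by norm_num) (by rwa [hX, card_filter_powersetCard _ (IsHandledBy d F)]) (by rwa [hX])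
  refine ⟨T.biUnion fun σ => σ⁻¹ • F, ⟨?_, fun A hA => ?_⟩, ?_⟩
  · refine biUnion_subset.2 fun σ _ S hS => ?_
    obtain ⟨S₀, hS₀, rfl⟩ := mem_smul_finset.1 hS
    rw [mem_powersetCard, card_smul_finset]
    exact ⟨subset_univ _, (mem_powersetCard.1 (hF hS₀)).2⟩
  · obtain ⟨σ, hσ, hhandled⟩ := hT ⟨A, (mem_powersetCard.1 hA).2⟩
    have := hhandled.smul σ⁻¹
    rw [Set.powersetCard.coe_smul, inv_smul_smul] at this
    exact this.mono (subset_biUnion_of_mem (fun σ => σ⁻¹ • F) hσ)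
  · refine (card_biUnion_le_card_mul _ _ #F fun σ _ => (card_smul_finset _ _).le).trans ?_
    gcongr

end Galvin

section Size

lemma one_sub_pow_mul_le_one {p D : ℝ} {K : ℕ} (hp : p ≤ 1) (hD : 0 < D)
    (hK : Real.log D ≤ K * p) : (1 - p) ^ K * D ≤ 1 := by
  rw [← le_div_iff₀ hD, one_div]
  calc (1 - p) ^ K ≤ Real.exp (-p) ^ K :=
        pow_le_pow_left₀ (sub_nonneg.2 hp) (Real.one_sub_le_exp_neg p) K
    _ = Real.exp (-(K * p)) := by rw [← Real.exp_nat_mul, mul_neg]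
    _ ≤ Real.exp (-Real.log D) := Real.exp_le_exp.2 (neg_le_neg hK)
    _ = D⁻¹ := by rw [Real.exp_neg, Real.exp_log hD]

lemma one_lt_log_four : 1 < Real.log 4 := by
  rw [Real.lt_log_iff_exp_lt (by norm_num)]
  linarith [Real.exp_one_lt_d9]

variable {d h n K : ℕ}

lemma four_le_sq_mul_pow (hd : 0 < d) (hn : 2 ≤ n) : (4 : ℝ) ≤ n ^ 2 * d ^ 9 :=
  calc (4 : ℝ) = 2 ^ 2 * 1 ^ 9 := by norm_num
    _ ≤ n ^ 2 * d ^ 9 := by gcongr <;> exact_mod_cast ‹_›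

lemma log_four_le_log (hd : 0 < d) (hn : 2 ≤ n) : Real.log 4 ≤ Real.log (n ^ 2 * d ^ 9) :=
  Real.log_le_log (by norm_num) (four_le_sq_mul_pow hd hn)

lemma log_le_three_mul_log (hd : 0 < d) (hh : 0 < h) (hn : n = 2 * (d * h)) :
    Real.log (16 * d ^ 2 * (h + 1)) ≤ 3 * Real.log (n ^ 2 * d ^ 9) := by
  have hn2 : 2 ≤ n := by rw [hn]; exact Nat.le_mul_of_pos_right 2 (Nat.mul_pos hd hh)
  have hhn : h + 1 ≤ n := by rw [hn]; nlinarith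
  have hbound : (d ^ 2 * (h + 1) : ℝ) ≤ n ^ 2 * d ^ 9 := by
    have h1 : (1 : ℝ) ≤ n := by exact_mod_cast (by omega : 1 ≤ n)
    have hd1 : (1 : ℝ) ≤ d := by exact_mod_cast hd
    calc (d ^ 2 * (h + 1) : ℝ) ≤ d ^ 9 * n := by
          gcongr
          · norm_num
          · exact_mod_cast hhn
      _ ≤ d ^ 9 * n ^ 2 := by gcongr; exact le_self_pow₀ h1 two_ne_zero
      _ = n ^ 2 * d ^ 9 := mul_comm _ _
  have hf := four_le_sq_mul_pow hd hn2
  rw [← Nat.cast_ofNat (n := 3), ← Real.log_pow]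
  refine Real.log_le_log (by positivity) ?_
  calc (16 * d ^ 2 * (h + 1) : ℝ) = 4 ^ 2 * (d ^ 2 * (h + 1)) := by ring
    _ ≤ (n ^ 2 * d ^ 9) ^ 2 * (n ^ 2 * d ^ 9) := by gcongr
    _ = (n ^ 2 * d ^ 9) ^ 3 := by ring

lemma one_le_mul_log (hd : 0 < d) (hh : 0 < h) (hn : 2 ≤ n) :
    1 ≤ d ^ 3 * √h * Real.log (n ^ 2 * d ^ 9) := by
  have hd3 : (1 : ℝ) ≤ d ^ 3 := one_le_pow₀ (by exact_mod_cast hd)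
  have hs : 1 ≤ √(h : ℝ) := Real.one_le_sqrt.2 (by exact_mod_cast hh)
  have hℓ : 1 ≤ Real.log (n ^ 2 * d ^ 9) := one_lt_log_four.le.trans (log_four_le_log hd hn)
  exact one_le_mul_of_one_le_of_one_le (one_le_mul_of_one_le_of_one_le hd3 hs) hℓ

lemma exists_sufficient_exponent (hd : 0 < d) (hh : 0 < h) (hn : n = 2 * (d * h)) :
    ∃ K : ℕ, (1 - hitProb d h) ^ K * (16 * d ^ 2 * (h + 1)) ≤ 1 ∧
      (K : ℝ) ≤ 2 ^ 22 * (d ^ 3 * √h * Real.log (n ^ 2 * d ^ 9)) := by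
  have hn2 : 2 ≤ n := by rw [hn]; exact Nat.le_mul_of_pos_right 2 (Nat.mul_pos hd hh)
  have hL := one_le_mul_log hd hh hn2
  set ℓ := Real.log (n ^ 2 * d ^ 9)
  refine ⟨⌈3 * 2 ^ 20 * (d ^ 3 * √h * ℓ)⌉₊,
    one_sub_pow_mul_le_one (hitProb_le_one hd hh) (by positivity) ?_, ?_⟩
  · calc Real.log (16 * d ^ 2 * (h + 1)) ≤ 3 * ℓ := log_le_three_mul_log hd hh hn
      _ = 3 * 2 ^ 20 * (d ^ 3 * √h * ℓ) * hitProb d h := by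
          unfold hitProb
          field_simp
      _ ≤ _ := by gcongr; exacts [hitProb_nonneg, Nat.le_ceil _]
  · have := (Nat.ceil_lt_add_one (by positivity : 0 ≤ 3 * 2 ^ 20 * (d ^ 3 * √h * ℓ))).le
    linarith

lemma succ_mul_sq_le (hd : 0 < d) (hh : 0 < h) (hn : n = 2 * (d * h))
    (hK : (K : ℝ) ≤ 2 ^ 22 * (d ^ 3 * √h * Real.log (n ^ 2 * d ^ 9))) :
    ((n : ℝ) + 1) * (2 * d + 8 * d ^ 2 * K) ^ 2 ≤
      2 ^ 51 * (n ^ 2 * d ^ 9) * Real.log (n ^ 2 * d ^ 9) ^ 2 := by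
  have hn2 : 2 ≤ n := by rw [hn]; exact Nat.le_mul_of_pos_right 2 (Nat.mul_pos hd hh)
  have hL := one_le_mul_log hd hh hn2
  set ℓ := Real.log (n ^ 2 * d ^ 9)
  have hd1 : (1 : ℝ) ≤ d := by exact_mod_cast hd
  have hn1 : (1 : ℝ) ≤ n := by exact_mod_cast one_le_two.trans hn2
  have hnR : (n : ℝ) = 2 * (d * h) := by exact_mod_cast hn
  have hss : √(h : ℝ) ^ 2 = h := Real.sq_sqrt (by positivity)
  have hdL : (d : ℝ) ≤ d ^ 2 * (d ^ 3 * √h * ℓ) :=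
    (le_self_pow₀ hd1 two_ne_zero).trans (le_mul_of_one_le_right (by positivity) hL)
  have hpieces : (2 * d + 8 * d ^ 2 * K : ℝ) ≤ 9 * 2 ^ 22 * (d ^ 2 * (d ^ 3 * √h * ℓ)) :=
    calc (2 * d + 8 * d ^ 2 * K : ℝ)
        ≤ 2 * (d ^ 2 * (d ^ 3 * √h * ℓ)) + 8 * d ^ 2 * (2 ^ 22 * (d ^ 3 * √h * ℓ)) := by gcongr
      _ ≤ 9 * 2 ^ 22 * (d ^ 2 * (d ^ 3 * √h * ℓ)) := by
          linarith [(Nat.cast_nonneg d : (0 : ℝ) ≤ d).trans hdL]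
  calc ((n : ℝ) + 1) * (2 * d + 8 * d ^ 2 * K) ^ 2
      ≤ (n + n) * (9 * 2 ^ 22 * (d ^ 2 * (d ^ 3 * √h * ℓ))) ^ 2 := by gcongr
    _ = 81 * 2 ^ 44 * (n * (2 * (d * h)) * d ^ 9 * ℓ ^ 2) := by
        linear_combination (2 * n * 81 * 2 ^ 44 * (d : ℝ) ^ 10 * ℓ ^ 2) * hss
    _ = 81 * 2 ^ 44 * (n ^ 2 * d ^ 9 * ℓ ^ 2) := by rw [← hnR, sq (n : ℝ)]
    _ ≤ 2 ^ 51 * (n ^ 2 * d ^ 9 * ℓ ^ 2) := by gcongr; norm_num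
    _ = 2 ^ 51 * (n ^ 2 * d ^ 9) * ℓ ^ 2 := by ring

lemma exists_isGalvinFamily_card_le (hn : 0 < n) (hdn : 2 * d ∣ n) :
    ∃ F : Finset (Finset (Fin n)), IsGalvinFamily d F ∧
      (#F : ℝ) ≤ 2 ^ 51 * (n ^ 2 * d ^ 9) * Real.log (n ^ 2 * d ^ 9) ^ 2 := by
  obtain ⟨h, hnh⟩ := hdn
  rw [mul_assoc] at hnh
  have hdh : 0 < d * h := by omega
  have hd := Nat.pos_of_mul_pos_right hdh
  have hh := Nat.pos_of_mul_pos_left hdh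
  obtain ⟨K, hK, hKle⟩ := exists_sufficient_exponent hd hh hnh
  obtain ⟨F₀, hF₀, hF₀K, hhalf⟩ := exists_family_handling_half hd hh hnh hK
  have hnd : n / d = 2 * h := by
    rw [hnh, mul_left_comm, Nat.mul_div_cancel_left _ hd]
  have hn2 : n / 2 = d * h := by rw [hnh, Nat.mul_div_cancel_left _ two_pos]
  obtain ⟨F, hF, hFn⟩ := exists_isGalvinFamily_of_half (d := d) (hnd ▸ hF₀) (by
    rw [hn2]
    convert hhalf
    rw [hnh]
    rfl)
  refine ⟨F, hF, ?_⟩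
  calc (#F : ℝ) ≤ ((n + 1) * (2 * d + 8 * d ^ 2 * K) ^ 2 : ℕ) :=
        Nat.cast_le.2 (hFn.trans (Nat.mul_le_mul_left _ hF₀K))
    _ = (n + 1) * (2 * d + 8 * d ^ 2 * K) ^ 2 := by push_cast; ring
    _ ≤ _ := succ_mul_sq_le hd hh hnh hKle

end Size

theorem theorem1 :
    ∃ c₁ c₂ : ℤ, ∀ d n : ℕ, 0 < n → 2 * d ∣ n →
      ∃ F : Finset (Finset (Fin n)), IsGalvinFamily d F ∧
        min (((n : ℝ) ^ 2 * (d : ℝ) ^ 9) * Real.log ((n : ℝ) ^ 2 * (d : ℝ) ^ 9) ^ c₁)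
            (n.choose (n / d) : ℝ) ≤ (F.card : ℝ) ∧
        (F.card : ℝ) ≤
          ((n : ℝ) ^ 2 * (d : ℝ) ^ 9) * Real.log ((n : ℝ) ^ 2 * (d : ℝ) ^ 9) ^ c₂ := by
  obtain ⟨k, hk⟩ := pow_unbounded_of_one_lt (2 ^ 51 : ℝ) one_lt_log_four
  refine ⟨0, (k + 2 : ℕ), fun d n hn hdn => ?_⟩
  obtain ⟨F, hF, hFcard⟩ := exists_isGalvinFamily_card_le hn hdn
  obtain ⟨F', hF', hF'card⟩ := hF.exists_card_eq (n ^ 2 * d ^ 9)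
  have hd : 0 < d := Nat.pos_of_ne_zero fun h0 => by simp [h0] at hdn; omega
  have hlog := log_four_le_log hd (n := n) (by have := Nat.le_of_dvd hn hdn; omega)
  set f : ℝ := (n : ℝ) ^ 2 * (d : ℝ) ^ 9
  have hcast : ((n ^ 2 * d ^ 9 : ℕ) : ℝ) = f := by push_cast; rfl
  have hℓ : 1 ≤ Real.log f := one_lt_log_four.le.trans hlog
  have hℓk : 2 ^ 51 ≤ Real.log f ^ k :=
    hk.le.trans (pow_le_pow_left₀ (zero_le_one.trans one_lt_log_four.le) hlog k)
  refine ⟨F', hF', ?_, ?_⟩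
  · rw [zpow_zero, mul_one, hF'card, ← hcast]
    exact_mod_cast le_max_right _ _
  · rw [zpow_natCast, hF'card, Nat.cast_max, Nat.cast_min, hcast]
    refine max_le ?_ ((min_le_left _ _).trans ?_)
    · calc (#F : ℝ) ≤ 2 ^ 51 * f * Real.log f ^ 2 := hFcard
        _ ≤ Real.log f ^ k * f * Real.log f ^ 2 := by gcongr
        _ = f * Real.log f ^ (k + 2) := by ring
    · exact le_mul_of_one_le_right (by positivity) (one_le_pow₀ hℓ)
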